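/- **Setting.** Let $J:\mathbb J\to\mathbb C$ be a functor. A *relative monad* on $J$ consists of an object mapping $T:|\mathbb J|\to|\mathbb C|$, maps $\eta_X:J X\to T X$ for every object $X$ of $\mathbb J$, and for every $k:JX\to TY$ a map $k^*:TX\to TY$, such that $k^*\circ\eta_X=k$, $\eta_X^*=\mathrm{id}_{TX}$ and $(\ell^*\circ k)^*=\ell^*\circ k^*$. It is a functor $\mathbb J\to\mathbb C$ via $Tf=(\eta\circ Jf)^*$. A morphism $\sigma:T\to T'$ is a family $\sigma_X:TX\to T'X$ with $\sigma_X\circ\eta_X=\eta'_X$ and $\sigma_Y\circ k^*=(\sigma_Y\circ k)^{*'}\circ\sigma_X$. These form the category $\mathbf{RMon}(J)$; $\mathbf{Mon}(\mathbb C)$ is the category of monads on $\mathbb C$. Left Kan extensions are pointwise: $\mathrm{Lan}_J F\,X=\int^{Y}\mathbb C(JY,X)\bullet FY$, with coprojections $\iota\,g:FY\to\mathrm{Lan}_JF\,X$ for $g:JY\to X$. The functor $J$ is *well-behaved* if $\mathrm{Lan}_JF$ exists for all $F:\mathbb J\to\mathbb C$ and (1) $J$ is fully faithful; (2) $J$ is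 dense, that is, the nerve $K:\mathbb C\to[\mathbb J^{\mathrm{op}},\mathbf{Set}]$, $KX=\mathbb C(J-,X)$, is fully faithful; (3) for all $F:\mathbb J\to\mathbb C$, $X\in\mathbb J$, $Y\in\mathbb C$, the left Kan extension $\mathrm{Lan}_J(\mathbb C(JX,F-))$ into $\mathbf{Set}$ exists and the canonical map $$L^F_{X,Y}:\mathrm{Lan}_J(\mathbb C(JX,F-))\,Y\to\mathbb C(JX,\mathrm{Lan}_JF\,Y)$$ induced by sending $g:JZ\to Y$ and $g':JX\to FZ$ to $\iota\,g\circ g'$ is a bijection. For well-behaved $J$ the natural maps $\bar\lambda:\mathrm{Lan}_JJ\to I$, $\bar\lambda\circ\iota\,g=g$, and $\bar\alpha_{F,G}:\mathrm{Lan}_J(\mathrm{Lan}_JF\cdot G)\to\mathrm{Lan}_JF\cdot\mathrm{Lan}_JG$, $\bar\alpha_{F,G}\circ\iota\,g=\mathrm{Lan}_JF\,(\iota\,g)$, are isomorphisms, and there are functors * *extension* $(-)^\sharp:\mathbf{RMon}(J)\to\mathbf{Mon}(\mathbb C)$, with $T^\sharp=\mathrm{Lan}_JT$, $\eta^\sharp=\mathrm{Lan}_J\eta\circ\bar\lambda^{-1}$,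 $\mu^\sharp=\mathrm{Lan}_J\mu\circ\bar\alpha_{T,T}^{-1}$, where $\mu:\mathrm{Lan}_JT\cdot T\to T$ is given by $\mu\circ\iota\,k=k^*$, and $\sigma^\sharp=\mathrm{Lan}_J\sigma$; * *restriction* $(-)^\flat:\mathbf{Mon}(\mathbb C)\to\mathbf{RMon}(J)$, with $T^\flat X=T(JX)$, $\eta^\flat_X=\eta_{JX}$, $k^{*}=\mu_{JY}\circ Tk$ for $k:JX\to T(JY)$, and $\sigma^\flat_X=\sigma_{JX}$. **Theorem.** Let $J:\mathbb J\to\mathbb C$ be well-behaved. Then $(-)^\sharp$ is left adjoint to $(-)^\flat$, by an adjunction whose unit at $T\in\mathbf{RMon}(J)$ is $\rho_T:T\to(T^\sharp)^\flat$, $(\rho_T)_X=\iota\,\mathrm{id}_{JX}:TX\to\mathrm{Lan}_JT\,(JX)$. Moreover this adjunction is a coreflection: its unit $\rho$ is an isomorphism. -/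

import Mathlib

open CategoryTheory Opposite

universe v₁ v₂ u₁ u₂

/-- A (Manes-style) relative monad on a functor `J : 𝕁 ⥤ C`. Compositions are written in
diagrammatic order: `f ≫ g` is `g ∘ f`. -/
structure RelativeMonad {𝕁 : Type u₁} [Category.{v₁} 𝕁] {C : Type u₂} [Category.{v₂} C]
    (J : 𝕁 ⥤ C) where
  /-- The object mapping `T`. -/
  obj : 𝕁 → C
  /-- The unit `η`. -/
  η (X : 𝕁) : J.obj X ⟶ obj X
  /-- The Kleisli extension `k ↦ k^*`. -/
  ext {X Y : 𝕁} (k : J.obj X ⟶ obj Y) : obj X ⟶ obj Y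
  η_ext {X Y : 𝕁} (k : J.obj X ⟶ obj Y) : η X ≫ ext k = k
  ext_η (X : 𝕁) : ext (η X) = 𝟙 (obj X)
  ext_comp {X Y Z : 𝕁} (k : J.obj X ⟶ obj Y) (l : J.obj Y ⟶ obj Z) :
    ext (k ≫ ext l) = ext k ≫ ext l

namespace RelativeMonad

section Basic

variable {𝕁 : Type u₁} [Category.{v₁} 𝕁] {C : Type u₂} [Category.{v₂} C] {J : 𝕁 ⥤ C}

/-- A morphism of relative monads on `J`. -/
structure Hom (T T' : RelativeMonad J) where
  app (X : 𝕁) : T.obj X ⟶ T'.obj X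
  η_app (X : 𝕁) : T.η X ≫ app X = T'.η X
  ext_app {X Y : 𝕁} (k : J.obj X ⟶ T.obj Y) :
    T.ext k ≫ app Y = app X ≫ T'.ext (k ≫ app Y)

theorem Hom.app_injective {T T' : RelativeMonad J} {σ τ : Hom T T'}
    (h : ∀ X, σ.app X = τ.app X) : σ = τ := by
  cases σ; cases τ; congr; exact funext h

/-- The category `RMon(J)` of relative monads on `J`. -/
instance : Category (RelativeMonad J) where
  Hom := Hom
  id T :=
    { app := fun X => 𝟙 (T.obj X)
      η_app := by simp
      ext_app := by simp }
  comp σ τ :=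
    { app := fun X => σ.app X ≫ τ.app X
      η_app := fun X => by rw [← Category.assoc, σ.η_app, τ.η_app]
      ext_app := fun k => by
        rw [← Category.assoc, σ.ext_app, Category.assoc, τ.ext_app]; simp }
  id_comp _ := Hom.app_injective fun _ => Category.id_comp _
  comp_id _ := Hom.app_injective fun _ => Category.comp_id _
  assoc _ _ _ := Hom.app_injective fun _ => Category.assoc _ _ _

/-- The functor underlying a relative monad: `T f = (η ∘ J f)^*`. -/
abbrev toFunctor (T : RelativeMonad J) : 𝕁 ⥤ C where
  obj := T.obj
  map f := T.ext (J.map f ≫ T.η _)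
  map_id X := by simp [T.ext_η]
  map_comp f g := by rw [← T.ext_comp, Category.assoc, T.η_ext]; simp

theorem map_ext (T : RelativeMonad J) {X X' Y : 𝕁} (h : X' ⟶ X) (k : J.obj X ⟶ T.obj Y) :
    T.toFunctor.map h ≫ T.ext k = T.ext (J.map h ≫ k) := by
  change T.ext _ ≫ T.ext k = _
  rw [← T.ext_comp, Category.assoc, T.η_ext]

/-- The natural transformation underlying a morphism of relative monads. -/
def Hom.toNatTrans {T T' : RelativeMonad J} (σ : Hom T T') : T.toFunctor ⟶ T'.toFunctor where
  app := σ.app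
  naturality X Y f := by
    change T.ext _ ≫ σ.app Y = σ.app X ≫ T'.ext _
    rw [σ.ext_app, Category.assoc, σ.η_app]

/-- The unit of a relative monad as a natural transformation. -/
def unit (T : RelativeMonad J) : J ⟶ T.toFunctor where
  app := T.η
  naturality _ _ _ := (T.η_ext _).symm

/-- Restriction `T ↦ T^♭` of monads on `C` to relative monads on `J`:
`T^♭ X = T (J X)`, `η^♭ = η_{J X}` and `k^* = μ ∘ T k`. -/
abbrev restriction (J : 𝕁 ⥤ C) : CategoryTheory.Monad C ⥤ RelativeMonad J where
  obj T :=
    { obj := fun X => T.obj (J.obj X)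
      η := fun X => T.η.app (J.obj X)
      ext := fun {_ Y} k => T.map k ≫ T.μ.app (J.obj Y)
      η_ext := fun {X Y} k => by
        rw [← Category.assoc, ← T.unit_naturality, Category.assoc, T.left_unit]
        exact Category.comp_id k
      ext_η := fun X => T.right_unit _
      ext_comp := fun k l => by
        simp [T.assoc, T.mu_naturality_assoc] }
  map σ :=
    { app := fun X => σ.app (J.obj X)
      η_app := fun X => σ.app_η _
      ext_app := fun k => by
        simp }
  map_id _ := rfl
  map_comp _ _ := rfl

end Basic

end RelativeMonad

section WellBehaved

variable {𝕁 : Type u₁} [Category.{v₁} 𝕁] {C : Type u₂} [Category.{v₂} C] (J : 𝕁 ⥤ C)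

/-- The nerve `K : C ⥤ [𝕁ᵒᵖ, Set]` of `J`, given by `K X = Hom(J -, X)`. -/
def relNerve : C ⥤ 𝕁ᵒᵖ ⥤ Type v₂ :=
  yoneda ⋙ (Functor.whiskeringLeft 𝕁ᵒᵖ Cᵒᵖ (Type v₂)).obj J.op

/-- The left Kan extension `Lan_J F` of every functor `F : 𝕁 ⥤ C` exists, in the sense of the
coend formula `Lan_J F X = ∫^Y Hom(J Y, X) • F Y` (that is, pointwise). -/
class HasRelLan : Prop where
  hasLan (F : 𝕁 ⥤ C) : J.HasPointwiseLeftKanExtension F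

instance [HasRelLan J] (F : 𝕁 ⥤ C) : J.HasPointwiseLeftKanExtension F := HasRelLan.hasLan F

/-- The canonical maps `L^F_{X,Y} : Lan_J (Hom(J X, F -)) Y ⟶ Hom(J X, Lan_J F Y)`, for `F` and `X`
fixed and natural in `Y`. This is the map induced by `g ↦ (g' ↦ ι g ∘ g')`
for `g : J Z ⟶ Y` and `g' : J X ⟶ F Z`, where `ι g : F Z ⟶ Lan_J F Y`. -/
noncomputable def relLanComparison [HasRelLan J] (F : 𝕁 ⥤ C) (X : 𝕁)
    [J.HasPointwiseLeftKanExtension (F ⋙ coyoneda.obj (op (J.obj X)))] :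
    J.leftKanExtension (F ⋙ coyoneda.obj (op (J.obj X))) ⟶
      J.lan.obj F ⋙ coyoneda.obj (op (J.obj X)) :=
  Functor.descOfIsLeftKanExtension _
    (J.leftKanExtensionUnit (F ⋙ coyoneda.obj (op (J.obj X)))) _
    (Functor.whiskerRight (J.lanUnit.app F) (coyoneda.obj (op (J.obj X))))

/-- Well-behaved functors: left Kan extensions along `J` exist, `J` is fully faithful, `J` is
dense (its nerve is fully faithful), and the canonical maps `L^F_{X,Y}` are invertible (which
includes the existence of their source). -/
class WellBehaved : Prop extends HasRelLan J where
  full : J.Full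
  faithful : J.Faithful
  nerve_full : (relNerve J).Full
  nerve_faithful : (relNerve J).Faithful
  hasLanHom (F : 𝕁 ⥤ C) (X : 𝕁) :
    J.HasPointwiseLeftKanExtension (F ⋙ coyoneda.obj (op (J.obj X)))
  isIso_comparison (F : 𝕁 ⥤ C) (X : 𝕁) (Y : C) : IsIso ((relLanComparison J F X).app Y)

end WellBehaved

namespace RelativeMonad

section Lan

variable {𝕁 : Type u₁} [Category.{v₁} 𝕁] {C : Type u₂} [Category.{v₂} C] {J : 𝕁 ⥤ C}
  [HasRelLan J]

/-- The maps `ι g : F Y ⟶ Lan_J F X` for `g : J Y ⟶ X`. -/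
noncomputable def lanι (F : 𝕁 ⥤ C) {Y : 𝕁} {X : C} (g : J.obj Y ⟶ X) :
    F.obj Y ⟶ (J.lan.obj F).obj X :=
  (J.lanUnit.app F).app Y ≫ (J.lan.obj F).map g

theorem lanι_map (F : 𝕁 ⥤ C) {Y : 𝕁} {X X' : C} (g : J.obj Y ⟶ X) (f : X ⟶ X') :
    lanι F g ≫ (J.lan.obj F).map f = lanι F (g ≫ f) := by
  simp [lanι]

theorem map_lanι (F : 𝕁 ⥤ C) {Y Y' : 𝕁} {X : C} (h : Y' ⟶ Y) (g : J.obj Y ⟶ X) :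
    F.map h ≫ lanι F g = lanι F (J.map h ≫ g) := by
  have := (J.lanUnit.app F).naturality h
  dsimp at this
  simp [lanι, reassoc_of% this]

theorem lanι_lanMap {F G : 𝕁 ⥤ C} (τ : F ⟶ G) {Y : 𝕁} {X : C} (g : J.obj Y ⟶ X) :
    lanι F g ≫ (J.lan.map τ).app X = τ.app Y ≫ lanι G g := by
  have h := congr_app (J.lanUnit.naturality τ) Y
  dsimp at h
  simp [lanι, reassoc_of% h]

/-- `Lan_J F X` is the colimit of `F Y` over `g : J Y ⟶ X`. -/
noncomputable def lanIsColimit (F : 𝕁 ⥤ C) (X : C) :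
    Limits.IsColimit
      ((Functor.LeftExtension.mk _ (J.leftKanExtensionUnit F)).coconeAt X) :=
  J.isPointwiseLeftKanExtensionLeftKanExtensionUnit F X

theorem lan_hom_ext {F : 𝕁 ⥤ C} {X Z : C} {a b : (J.lan.obj F).obj X ⟶ Z}
    (h : ∀ (Y : 𝕁) (g : J.obj Y ⟶ X), lanι F g ≫ a = lanι F g ≫ b) : a = b :=
  (lanIsColimit F X).hom_ext fun j => h j.left j.hom

/-- The map `[θ] : Lan_J F X ⟶ Z` induced by `θ : Hom(J -, X) ⟶ Hom(F -, Z)`. -/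
noncomputable def lanDesc {F : 𝕁 ⥤ C} {X Z : C} (θ : ∀ Y : 𝕁, (J.obj Y ⟶ X) → (F.obj Y ⟶ Z))
    (hθ : ∀ {Y Y' : 𝕁} (h : Y' ⟶ Y) (g : J.obj Y ⟶ X),
      F.map h ≫ θ Y g = θ Y' (J.map h ≫ g)) :
    (J.lan.obj F).obj X ⟶ Z :=
  (lanIsColimit F X).desc
    { pt := Z
      ι :=
        { app := fun j => θ j.left j.hom
          naturality := fun j j' f => by
            have h := hθ f.left j'.hom
            rw [CostructuredArrow.w f] at h
            exact h.trans (Category.comp_id _).symm } }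

theorem lanι_desc {F : 𝕁 ⥤ C} {X Z : C} (θ : ∀ Y : 𝕁, (J.obj Y ⟶ X) → (F.obj Y ⟶ Z))
    (hθ : ∀ {Y Y' : 𝕁} (h : Y' ⟶ Y) (g : J.obj Y ⟶ X),
      F.map h ≫ θ Y g = θ Y' (J.map h ≫ g)) {Y : 𝕁} (g : J.obj Y ⟶ X) :
    lanι F g ≫ lanDesc θ hθ = θ Y g :=
  (lanIsColimit F X).fac _ (CostructuredArrow.mk g)

/-- `ρ_F : F ⟶ Lan_J F ∘ J`, given by `ρ_F = ι id`. -/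
noncomputable def lanRho (F : 𝕁 ⥤ C) : F ⟶ J ⋙ J.lan.obj F where
  app X := lanι F (𝟙 (J.obj X))
  naturality X X' f := by
    rw [Functor.comp_map, lanι_map, map_lanι, Category.comp_id, Category.id_comp]

/-- `λ̄ : Lan_J J ⟶ I`, given by `λ̄ ∘ ι g = g`. -/
noncomputable def lanCounit (J : 𝕁 ⥤ C) [HasRelLan J] : J.lan.obj J ⟶ 𝟭 C where
  app X := lanDesc (fun _ g => g) (fun _ _ => rfl)
  naturality X X' f := lan_hom_ext fun Y g => by
    rw [← Category.assoc, lanι_map, lanι_desc, ← Category.assoc, lanι_desc]; rfl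

theorem lanι_counit {Y : 𝕁} {X : C} (g : J.obj Y ⟶ X) :
    lanι J g ≫ (lanCounit J).app X = g :=
  lanι_desc (fun _ g => g) (fun _ _ => rfl) g

/-- `ᾱ_{F,G} : Lan_J (Lan_J F ∘ G) ⟶ Lan_J F ∘ Lan_J G`, given by
`ᾱ ∘ ι g = Lan_J F (ι g)`. -/
noncomputable def lanAssoc (F G : 𝕁 ⥤ C) :
    J.lan.obj (G ⋙ J.lan.obj F) ⟶ J.lan.obj G ⋙ J.lan.obj F where
  app X := lanDesc (fun _ g => (J.lan.obj F).map (lanι G g)) (fun h g => by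
    rw [Functor.comp_map, ← Functor.map_comp, map_lanι])
  naturality X X' f := lan_hom_ext fun Y g => by
    rw [← Category.assoc, lanι_map, lanι_desc, ← Category.assoc, lanι_desc, Functor.comp_map,
      ← Functor.map_comp, lanι_map]

theorem lanι_assoc (F G : 𝕁 ⥤ C) {Y : 𝕁} {X : C} (g : J.obj Y ⟶ X) :
    lanι (G ⋙ J.lan.obj F) g ≫ (lanAssoc F G).app X = (J.lan.obj F).map (lanι G g) :=
  lanι_desc (F := G ⋙ J.lan.obj F) (fun _ g => (J.lan.obj F).map (lanι G g))
    (fun h g => by rw [Functor.comp_map, ← Functor.map_comp, map_lanι]) g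

/-- The component `μ_X = [k ↦ k^*] : Lan_J T (T X) ⟶ T X` of the multiplication of a relative
monad. -/
noncomputable def mulApp (T : RelativeMonad J) (X : 𝕁) :
    (J.lan.obj T.toFunctor).obj (T.obj X) ⟶ T.obj X :=
  lanDesc (F := T.toFunctor) (fun _ k => T.ext k) (fun h k => T.map_ext h k)

theorem lanι_mulApp (T : RelativeMonad J) {X Y : 𝕁} (k : J.obj X ⟶ T.obj Y) :
    lanι T.toFunctor k ≫ T.mulApp Y = T.ext k :=
  lanι_desc (F := T.toFunctor) (fun _ k => T.ext k) (fun h k => T.map_ext h k) k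

/-- The multiplication `μ : Lan_J T ∘ T ⟶ T` of a relative monad. -/
noncomputable def mul (T : RelativeMonad J) :
    T.toFunctor ⋙ J.lan.obj T.toFunctor ⟶ T.toFunctor where
  app X := T.mulApp X
  naturality X X' f := lan_hom_ext (F := T.toFunctor) (X := T.obj X) fun Y g => by
    let f' : T.obj X ⟶ T.obj X' := T.ext (J.map f ≫ T.η X')
    change lanι T.toFunctor g ≫ (J.lan.obj T.toFunctor).map f' ≫ T.mulApp X' =
      lanι T.toFunctor g ≫ T.mulApp X ≫ f'
    rw [← Category.assoc, lanι_map, lanι_mulApp, ← Category.assoc, lanι_mulApp]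
    exact T.ext_comp _ _

end Lan

section Extension

variable {𝕁 : Type u₁} [Category.{v₁} 𝕁] {C : Type u₂} [Category.{v₂} C] {J : 𝕁 ⥤ C}
  [WellBehaved J]

theorem dense_hom_ext {X Z : C} {a b : X ⟶ Z}
    (h : ∀ (Y : 𝕁) (g : J.obj Y ⟶ X), g ≫ a = g ≫ b) : a = b := by
  have := WellBehaved.nerve_faithful (J := J)
  apply (relNerve J).map_injective
  ext Y g
  exact h Y.unop g

theorem exists_dense_desc {X Z : C} (θ : ∀ Y : 𝕁, (J.obj Y ⟶ X) → (J.obj Y ⟶ Z))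
    (hθ : ∀ {Y Y' : 𝕁} (h : Y' ⟶ Y) (g : J.obj Y ⟶ X),
      J.map h ≫ θ Y g = θ Y' (J.map h ≫ g)) :
    ∃ f : X ⟶ Z, ∀ (Y : 𝕁) (g : J.obj Y ⟶ X), g ≫ f = θ Y g := by
  have := WellBehaved.nerve_full (J := J)
  let τ : (relNerve J).obj X ⟶ (relNerve J).obj Z :=
    { app := fun Y => ↾fun g => θ Y.unop g
      naturality := fun Y Y' h => by
        ext g
        exact (hθ h.unop g).symm }
  obtain ⟨f, hf⟩ := (relNerve J).map_surjective τ
  refine ⟨f, fun Y g => ?_⟩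
  have := ConcreteCategory.congr_hom (congr_app hf (op Y)) g
  exact this

instance : IsIso (lanCounit J) := by
  have (X : C) : IsIso ((lanCounit J).app X) := by
    obtain ⟨e, he⟩ := exists_dense_desc (J := J) (X := X) (Z := (J.lan.obj J).obj X)
      (fun _ g => lanι (J := J) J g) (fun h g => map_lanι (J := J) J h g)
    refine ⟨e, lan_hom_ext fun Y g => ?_, dense_hom_ext (J := J) fun Y g => ?_⟩
    · rw [← Category.assoc, lanι_counit, he, Category.comp_id]
    · rw [← Category.assoc, he, lanι_counit]
      exact (Category.comp_id g).symm
  exact NatIso.isIso_of_isIso_app _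

theorem nonempty_isColimit_hom (F : 𝕁 ⥤ C) (X : 𝕁) (Y : C) :
    Nonempty (Limits.IsColimit
      ((Functor.LeftExtension.mk (J.lan.obj F ⋙ coyoneda.obj (op (J.obj X)))
        (Functor.whiskerRight (J.lanUnit.app F) (coyoneda.obj (op (J.obj X))) :
          F ⋙ coyoneda.obj (op (J.obj X)) ⟶
            J ⋙ J.lan.obj F ⋙ coyoneda.obj (op (J.obj X)))).coconeAt Y)) := by
  have := WellBehaved.hasLanHom (J := J)
  have := WellBehaved.isIso_comparison (J := J) F X
  have : IsIso (relLanComparison J F X) := NatIso.isIso_of_isIso_app _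
  have := (Functor.isLeftKanExtension_iff_isIso (relLanComparison J F X)
    (J.leftKanExtensionUnit (F ⋙ coyoneda.obj (op (J.obj X))))
    (Functor.whiskerRight (J.lanUnit.app F) (coyoneda.obj (op (J.obj X))))
    (Functor.descOfIsLeftKanExtension_fac _ _ _ _)).2 this
  exact ⟨Functor.isPointwiseLeftKanExtensionOfIsLeftKanExtension _ _ Y⟩

theorem exists_eq_comp_lanι {F : 𝕁 ⥤ C} {X : 𝕁} {Y : C} (h : J.obj X ⟶ (J.lan.obj F).obj Y) :
    ∃ (Z : 𝕁) (g : J.obj Z ⟶ Y) (k : J.obj X ⟶ F.obj Z), h = k ≫ lanι F g := by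
  obtain ⟨c⟩ := nonempty_isColimit_hom (J := J) F X Y
  obtain ⟨j, k, hk⟩ := Limits.Types.jointly_surjective_of_isColimit c h
  refine ⟨j.left, j.hom, k, hk.symm.trans ?_⟩
  exact Category.assoc _ _ _

theorem exists_hom_desc {F : 𝕁 ⥤ C} {X : 𝕁} {Y : C} {S : Type v₂}
    (θ : ∀ Z : 𝕁, (J.obj Z ⟶ Y) → (J.obj X ⟶ F.obj Z) → S)
    (hθ : ∀ {Z Z' : 𝕁} (h : Z' ⟶ Z) (g : J.obj Z ⟶ Y) (k : J.obj X ⟶ F.obj Z'),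
      θ Z g (k ≫ F.map h) = θ Z' (J.map h ≫ g) k) :
    ∃ φ : (J.obj X ⟶ (J.lan.obj F).obj Y) → S,
      ∀ (Z : 𝕁) (g : J.obj Z ⟶ Y) (k : J.obj X ⟶ F.obj Z), φ (k ≫ lanι F g) = θ Z g k := by
  obtain ⟨c⟩ := nonempty_isColimit_hom (J := J) F X Y
  let s : Limits.Cocone (CostructuredArrow.proj J Y ⋙ F ⋙ coyoneda.obj (op (J.obj X))) :=
    { pt := S
      ι :=
        { app := fun j => ↾fun k => θ j.left j.hom k
          naturality := fun j j' f => by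
            ext k
            have := hθ f.left j'.hom k
            rw [CostructuredArrow.w f] at this
            exact this } }
  refine ⟨fun h => c.desc s h, fun Z g k => ?_⟩
  have := ConcreteCategory.congr_hom (c.fac s (CostructuredArrow.mk g)) k
  refine Eq.trans ?_ this
  exact congrArg (c.desc s) (Category.assoc _ _ _).symm

instance (F G : 𝕁 ⥤ C) : IsIso (lanAssoc (J := J) F G) := by
  have (X : C) : IsIso ((lanAssoc (J := J) F G).app X) := by
    have key (Y : 𝕁) := exists_hom_desc (J := J) (F := G) (X := Y) (Y := X)
      (S := F.obj Y ⟶ (J.lan.obj (G ⋙ J.lan.obj F)).obj X)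
      (fun Z g k => lanι F k ≫ lanι (G ⋙ J.lan.obj F) g)
      (fun h g k => by
        rw [← lanι_map, Category.assoc]
        exact congrArg _ (map_lanι (G ⋙ J.lan.obj F) h g))
    choose φ hφ using key
    let e : (J.lan.obj F).obj ((J.lan.obj G).obj X) ⟶ (J.lan.obj (G ⋙ J.lan.obj F)).obj X :=
      lanDesc (fun Y h => φ Y h) (fun {Y Y'} h g => by
        obtain ⟨Z, g, k, rfl⟩ := exists_eq_comp_lanι g
        rw [hφ, ← Category.assoc, ← Category.assoc, hφ, map_lanι])
    have he {Y Z : 𝕁} (k : J.obj Y ⟶ G.obj Z) (g : J.obj Z ⟶ X) :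
        lanι F (k ≫ lanι G g) ≫ e = lanι F k ≫ lanι (G ⋙ J.lan.obj F) g := by
      dsimp only [e]
      rw [lanι_desc, hφ]
    refine ⟨e, lan_hom_ext fun Y g => ?_, lan_hom_ext fun Y h => ?_⟩
    · rw [← Category.assoc, lanι_assoc, Category.comp_id]
      refine lan_hom_ext (F := F) (X := G.obj Y) fun Z k => ?_
      rw [← Category.assoc, lanι_map, he]
    · obtain ⟨Z, g, k, rfl⟩ := exists_eq_comp_lanι h
      rw [← Category.assoc, he, Category.assoc, lanι_assoc, lanι_map]
      exact (Category.comp_id _).symm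
  exact NatIso.isIso_of_isIso_app _

/-- The unit `η^♯ = Lan_J η ∘ λ̄⁻¹`. -/
noncomputable def sharpUnit (T : RelativeMonad J) : 𝟭 C ⟶ J.lan.obj T.toFunctor :=
  inv (lanCounit J) ≫ J.lan.map T.unit

/-- The multiplication `μ^♯ = Lan_J μ ∘ ᾱ_{T,T}⁻¹`. -/
noncomputable def sharpMul (T : RelativeMonad J) :
    J.lan.obj T.toFunctor ⋙ J.lan.obj T.toFunctor ⟶ J.lan.obj T.toFunctor :=
  inv (lanAssoc T.toFunctor T.toFunctor) ≫ J.lan.map T.mul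

theorem comp_sharpUnit (T : RelativeMonad J) {Y : 𝕁} {X : C} (g : J.obj Y ⟶ X) :
    g ≫ T.sharpUnit.app X = T.η Y ≫ lanι T.toFunctor g := by
  have h : (lanCounit J).app X ≫ T.sharpUnit.app X = (J.lan.map T.unit).app X := by
    rw [← NatTrans.comp_app, sharpUnit, IsIso.hom_inv_id_assoc]
  rw [← lanι_counit g, Category.assoc, h, lanι_lanMap, lanι_counit]
  rfl

theorem lanι_sharpMul (T : RelativeMonad J) {Y Z : 𝕁} {X : C} (k : J.obj Y ⟶ T.obj Z)
    (g : J.obj Z ⟶ X) :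
    lanι T.toFunctor (k ≫ lanι T.toFunctor g) ≫ T.sharpMul.app X =
      T.ext k ≫ lanι T.toFunctor g := by
  have h : (lanAssoc T.toFunctor T.toFunctor).app X ≫ T.sharpMul.app X =
      (J.lan.map T.mul).app X := by
    rw [← NatTrans.comp_app, sharpMul, IsIso.hom_inv_id_assoc]
  rw [← lanι_map, ← lanι_assoc, Category.assoc, Category.assoc, h, lanι_lanMap,
    ← Category.assoc]
  exact congrArg (· ≫ lanι T.toFunctor g) (T.lanι_mulApp k)

/-- The extension `T^♯ = Lan_J T` of a relative monad on a well-behaved functor `J : 𝕁 ⥤ C` to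
a monad on `C`. -/
noncomputable abbrev sharp (T : RelativeMonad J) : CategoryTheory.Monad C where
  toFunctor := J.lan.obj T.toFunctor
  η := T.sharpUnit
  μ := T.sharpMul
  assoc X := lan_hom_ext fun Y h => by
    obtain ⟨Z, g, k, rfl⟩ := exists_eq_comp_lanι h
    obtain ⟨W, f, l, rfl⟩ := exists_eq_comp_lanι g
    change J.obj Y ⟶ T.obj Z at k
    change J.obj Z ⟶ T.obj W at l
    have h₁ : lanι T.toFunctor (k ≫ lanι T.toFunctor (l ≫ lanι T.toFunctor f)) ≫
        (J.lan.obj T.toFunctor).map (T.sharpMul.app X) =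
        lanι T.toFunctor ((k ≫ T.ext l) ≫ lanι T.toFunctor f) := by
      rw [lanι_map, Category.assoc, lanι_sharpMul, Category.assoc]
    rw [← Category.assoc, h₁, lanι_sharpMul, T.ext_comp]
    have h₂ := T.lanι_sharpMul k (l ≫ lanι T.toFunctor f)
    refine Eq.trans ?_ (congrArg (· ≫ T.sharpMul.app X) h₂).symm |>.trans
      (Category.assoc _ _ _)
    rw [Category.assoc, Category.assoc, lanι_sharpMul]
  left_unit X := dense_hom_ext (J := J) fun Y h => by
    obtain ⟨Z, g, k, rfl⟩ := exists_eq_comp_lanι h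
    have h₁ := congrArg (· ≫ T.sharpMul.app X) (T.comp_sharpUnit (k ≫ lanι T.toFunctor g))
    refine (Category.assoc _ _ _).symm.trans (h₁.trans ?_)
    dsimp only
    rw [Category.assoc, lanι_sharpMul, ← Category.assoc, T.η_ext]
    exact (Category.comp_id _).symm
  right_unit X := lan_hom_ext fun Y g => by
    have h₁ := congrArg (fun f => lanι T.toFunctor f ≫ T.sharpMul.app X) (T.comp_sharpUnit g)
    rw [← Category.assoc, lanι_map]
    refine h₁.trans ((T.lanι_sharpMul (X := X) (T.η Y) g).trans ?_)
    rw [T.ext_η]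
    exact (Category.id_comp _).trans (Category.comp_id _).symm

/-- Extension `T ↦ T^♯`, `σ ↦ Lan_J σ` of relative monads on a well-behaved functor
`J : 𝕁 ⥤ C` to monads on `C`. -/
noncomputable abbrev extension (J : 𝕁 ⥤ C) [WellBehaved J] :
    RelativeMonad J ⥤ CategoryTheory.Monad C where
  obj T := T.sharp
  map {T T'} σ :=
    { toNatTrans := J.lan.map (Hom.toNatTrans σ)
      app_η := fun X => dense_hom_ext (J := J) fun Y g => by
        have h₁ := congrArg (· ≫ (J.lan.map (Hom.toNatTrans σ)).app X) (T.comp_sharpUnit g)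
        refine (Category.assoc _ _ _).symm.trans (h₁.trans (Eq.trans ?_ (T'.comp_sharpUnit g).symm))
        refine (Category.assoc _ _ _).trans ((congrArg (T.η Y ≫ ·)
          (lanι_lanMap (J := J) (Hom.toNatTrans σ) (X := X) g)).trans ?_)
        refine (Category.assoc _ _ _).symm.trans ?_
        exact congrArg (· ≫ lanι T'.toFunctor g) (Hom.η_app σ Y)
      app_μ := fun X => lan_hom_ext fun Y h => by
        obtain ⟨Z, g, k, rfl⟩ := exists_eq_comp_lanι h
        let s := J.lan.map (Hom.toNatTrans σ)
        change lanι T.toFunctor (k ≫ lanι T.toFunctor g) ≫ T.sharpMul.app X ≫ s.app X =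
          lanι T.toFunctor (k ≫ lanι T.toFunctor g) ≫
            ((J.lan.obj T.toFunctor).map (s.app X) ≫ s.app _) ≫ T'.sharpMul.app X
        have h₁ : lanι T.toFunctor (k ≫ lanι T.toFunctor g) ≫
            (J.lan.obj T.toFunctor).map (s.app X) =
            lanι T.toFunctor (k ≫ (Hom.toNatTrans σ).app Z ≫ lanι T'.toFunctor g) := by
          rw [lanι_map, Category.assoc, lanι_lanMap]
        have h₂ := T'.lanι_sharpMul (k ≫ Hom.app σ Z) g
        rw [Category.assoc] at h₂
        rw [← Category.assoc, lanι_sharpMul, Category.assoc, lanι_lanMap, Category.assoc,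
          ← Category.assoc (lanι T.toFunctor _), h₁, ← Category.assoc (lanι T.toFunctor _),
          lanι_lanMap, Category.assoc]
        refine Eq.trans ?_ (congrArg (Hom.app σ Y ≫ ·) h₂.symm)
        dsimp only
        rw [← Category.assoc, ← Category.assoc, ← Hom.ext_app σ k]
        rfl }
  map_id T := by
    apply MonadHom.ext'
    exact congrArg NatTrans.app (J.lan.map_id T.toFunctor)
  map_comp σ τ := by
    apply MonadHom.ext'
    exact congrArg NatTrans.app (J.lan.map_comp (Hom.toNatTrans σ) (Hom.toNatTrans τ))

end Extension

end RelativeMonad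

/-! By the colimit property, a map out of `Lan_J F X` is determined by its composites with the
coprojections `ι g`, so the whole adjunction can be described on these. The unit is `ρ = ι id`, and
the counit `Lan_J (S ∘ J) X ⟶ S X` sends `ι g` to `S g` (`counitApp`). On coprojections the triangle
identities become `Lan_J T (g) ∘ ι id = ι g` and `S id = id`.

The real work is that these are morphisms of (relative) monads. The unit and multiplication of `T^♯`
involve inverses of `λ̄` and `ᾱ`, but `comp_sharpUnit` and `lanι_sharpMul` compute them without
inverses: `η^♯ ∘ g = ι g ∘ η`, and `μ^♯ ∘ ι (ι g ∘ k) = ι g ∘ k^*`. These formulas suffice because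
density lets maps be tested on arrows `J Y ⟶ X`, and surjectivity of the comparison `L` writes every
arrow `J Y ⟶ Lan_J T X` as `ι g ∘ k`.

The unit is invertible because full faithfulness of `J` makes the identity terminal among arrows `J
Y ⟶ J X`, so that the colimit defining `Lan_J F (J X)` is `F X`. -/

namespace RelativeMonad

/-! ### Isomorphisms of relative monads; the functor underlying a restriction -/

section Basic

variable {𝕁 : Type u₁} [Category.{v₁} 𝕁] {C : Type u₂} [Category.{v₂} C] {J : 𝕁 ⥤ C}

/-- A morphism of relative monads is an isomorphism if all its components are. -/
theorem isIso_of_isIso_app {T T' : RelativeMonad J} (σ : T ⟶ T')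
    (h : ∀ X, IsIso (Hom.app σ X)) : IsIso σ := by
  let τ : Hom T' T :=
    { app := fun X => inv (Hom.app σ X)
      η_app := fun X => by rw [IsIso.comp_inv_eq, Hom.η_app]
      -- Cancelling the inverses reduces this to the compatibility of `σ` with the extension of `k ≫
      -- inv σ`.
      ext_app := fun {X Y} k => by
        rw [IsIso.comp_inv_eq, Category.assoc, Hom.ext_app, IsIso.inv_hom_id_assoc,
          Category.assoc, IsIso.inv_hom_id, Category.comp_id] }
  exact ⟨τ, Hom.app_injective fun X => IsIso.hom_inv_id (Hom.app σ X),
    Hom.app_injective fun X => IsIso.inv_hom_id (Hom.app σ X)⟩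

/-- The right unit law of `S` cancels the unit in `(η ∘ J h)^*`. Thus `S^♭` has underlying functor
`S ∘ J`, which makes `ι g ↦ S g` a compatible family. -/
theorem restriction_map (S : CategoryTheory.Monad C) {X Y : 𝕁} (h : X ⟶ Y) :
    ((restriction J).obj S).toFunctor.map h = S.map (J.map h) := by
  change S.map (J.map h ≫ S.η.app (J.obj Y)) ≫ S.μ.app (J.obj Y) = _
  rw [Functor.map_comp, Category.assoc, S.right_unit]
  exact Category.comp_id _

end Basic

/-! ### Invertibility of `ρ` and the counit on coprojections -/

section Lan

variable {𝕁 : Type u₁} [Category.{v₁} 𝕁] {C : Type u₂} [Category.{v₂} C] {J : 𝕁 ⥤ C}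
  [HasRelLan J]

/-- For fully faithful `J`, the unit `F ⟶ Lan_J F ∘ J` is invertible. -/
theorem isIso_lanRho_app [J.Full] [J.Faithful] (F : 𝕁 ⥤ C) (X : 𝕁) :
    IsIso ((lanRho (J := J) F).app X) := by
  -- Each `g : J Y ⟶ J X` is `J h` for a unique `h`, and the inverse sends `ι g` to `F h`;
  -- uniqueness gives compatibility.
  let e : (J.lan.obj F).obj (J.obj X) ⟶ F.obj X :=
    lanDesc (fun _ g => F.map (J.preimage g)) (fun h g => by
      rw [← F.map_comp]
      exact congrArg F.map (J.map_injective (by simp)))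
  have he {Y : 𝕁} (g : J.obj Y ⟶ J.obj X) : lanι F g ≫ e = F.map (J.preimage g) :=
    lanι_desc _ _ g
  refine ⟨e, ?_, lan_hom_ext fun Y g => ?_⟩
  · exact (he _).trans (by rw [J.preimage_id, F.map_id])
  · rw [← Category.assoc, he]
    -- With `g = J h`, dinaturality of `ι` gives `ι id ∘ F h = ι g`.
    refine (map_lanι F _ _).trans ?_
    rw [J.map_preimage, Category.comp_id]
    exact (Category.comp_id _).symm

/-- The component `Lan_J (S ∘ J) X ⟶ S X` of the counit at a monad `S`, given by
`ι g ↦ S g`. -/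
noncomputable def counitApp (S : CategoryTheory.Monad C) (X : C) :
    (J.lan.obj ((restriction J).obj S).toFunctor).obj X ⟶ S.obj X :=
  lanDesc (F := ((restriction J).obj S).toFunctor) (fun _ g => S.map g) (fun h g => by
    rw [restriction_map, ← S.map_comp])

theorem lanι_counitApp (S : CategoryTheory.Monad C) {Y : 𝕁} {X : C} (g : J.obj Y ⟶ X) :
    lanι ((restriction J).obj S).toFunctor g ≫ counitApp S X = S.map g :=
  lanι_desc (F := ((restriction J).obj S).toFunctor) (fun _ g => S.map g) (fun h g => by
    rw [restriction_map, ← S.map_comp]) g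

end Lan

/-! ### Unit and counit as monad morphisms; the adjunction -/

section Extension

variable {𝕁 : Type u₁} [Category.{v₁} 𝕁] {C : Type u₂} [Category.{v₂} C] {J : 𝕁 ⥤ C}
  [WellBehaved J]

/-- The unit `ρ_T : T ⟶ (T^♯)^♭` as a morphism of relative monads. -/
noncomputable def rho (T : RelativeMonad J) :
    T ⟶ (restriction J).obj ((extension J).obj T) where
  app X := (lanRho T.toFunctor).app X
  η_app X := (T.comp_sharpUnit (𝟙 (J.obj X))).symm.trans (Category.id_comp _)
  ext_app {X Y} k := by
    -- The formula for `μ^♯` at `g = id` leaves `ι (ι id ∘ k)`, which is `Lan_J T (ι id ∘ k) ∘ ι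
    -- id`.
    refine (T.lanι_sharpMul k (𝟙 (J.obj Y))).symm.trans ?_
    refine Eq.trans ?_ (Category.assoc _ _ _)
    refine congrArg (· ≫ T.sharpMul.app (J.obj Y)) ?_
    exact ((lanι_map _ _ _).trans (congrArg _ (Category.id_comp _))).symm

/-- The counit `(S^♭)^♯ ⟶ S` as a morphism of monads. -/
noncomputable def sharpCounit (S : CategoryTheory.Monad C) :
    (extension J).obj ((restriction J).obj S) ⟶ S where
  app X := counitApp S X
  naturality X X' f := lan_hom_ext fun Y g => by
    dsimp only
    rw [← Category.assoc, lanι_map, lanι_counitApp, ← Category.assoc, lanι_counitApp,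
      S.map_comp]
  -- The source is `X` itself, not a Kan extension, so density replaces testing on coprojections.
  -- Both sides then agree by naturality of the unit of `S`.
  app_η X := dense_hom_ext (J := J) fun Y g => by
    have h := congrArg (· ≫ counitApp S X) (((restriction J).obj S).comp_sharpUnit g)
    refine (Category.assoc _ _ _).symm.trans (h.trans ((Category.assoc _ _ _).trans ?_))
    exact (congrArg (S.η.app (J.obj Y) ≫ ·) (lanι_counitApp S g)).trans
      (S.η.naturality g).symm
  app_μ X := lan_hom_ext fun Y h => by
    -- After factoring `h` as `ι g ∘ k`, one side becomes `S g ∘ μ ∘ S k` and the other `μ ∘ S (S g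
    -- ∘ k)`; naturality of `μ` identifies them.
    obtain ⟨Z, g, k, rfl⟩ := exists_eq_comp_lanι h
    let T := (restriction J).obj S
    change J.obj Y ⟶ S.obj (J.obj Z) at k
    have h₁ : lanι T.toFunctor (k ≫ lanι T.toFunctor g) ≫ T.sharpMul.app X ≫ counitApp S X =
        S.map k ≫ S.μ.app (J.obj Z) ≫ S.map g := by
      have := congrArg (· ≫ counitApp S X) (T.lanι_sharpMul k g)
      refine (Category.assoc _ _ _).symm.trans (this.trans ((Category.assoc _ _ _).trans ?_))
      rw [lanι_counitApp]
      exact Category.assoc _ _ _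
    have h₂ : lanι T.toFunctor (k ≫ lanι T.toFunctor g) ≫
        (J.lan.obj T.toFunctor).map (counitApp S X) = lanι T.toFunctor (k ≫ S.map g) := by
      rw [lanι_map, Category.assoc, lanι_counitApp]
    refine h₁.trans ?_
    change _ = lanι T.toFunctor (k ≫ lanι T.toFunctor g) ≫
      ((J.lan.obj T.toFunctor).map (counitApp S X) ≫ counitApp S (S.obj X)) ≫ S.μ.app X
    have h₃ : lanι T.toFunctor (k ≫ S.map g) ≫ counitApp S (S.obj X) =
        S.map (k ≫ S.map g) := lanι_counitApp S _
    rw [Category.assoc, ← Category.assoc (lanι T.toFunctor _), h₂,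
      ← Category.assoc (lanι T.toFunctor _), h₃,
      S.map_comp, Category.assoc]
    exact congrArg (S.map k ≫ ·) (S.μ.naturality g).symm

/-- The adjunction between extension and restriction. -/
noncomputable def extensionAdjunction (J : 𝕁 ⥤ C) [WellBehaved J] :
    extension J ⊣ restriction J where
  unit :=
    { app := rho
      naturality := fun T T' σ => Hom.app_injective fun X =>
        (lanι_lanMap (J := J) (Hom.toNatTrans σ) (𝟙 (J.obj X))).symm }
  counit :=
    { app := sharpCounit
      naturality := fun S S' σ => by
        apply MonadHom.ext'
        funext X
        refine lan_hom_ext fun Y g => ?_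
        let τ := Hom.toNatTrans ((restriction J).map σ)
        change lanι _ g ≫ (J.lan.map τ).app X ≫ counitApp S' X =
          lanι _ g ≫ counitApp S X ≫ σ.app X
        rw [← Category.assoc, lanι_lanMap, Category.assoc, lanι_counitApp, ← Category.assoc,
          lanι_counitApp]
        exact (σ.naturality g).symm }
  left_triangle_components T := by
    apply MonadHom.ext'
    funext X
    refine lan_hom_ext fun Y g => ?_
    change lanι T.toFunctor g ≫ (J.lan.map (Hom.toNatTrans (rho T))).app X ≫
      counitApp T.sharp X = lanι T.toFunctor g ≫ 𝟙 _
    -- `Lan_J ρ` turns `ι g` into `ι g ∘ ρ`, and the counit at `T^♯` turns the outer `ι g` into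
    -- `Lan_J T (g)`; what remains is `Lan_J T (g) ∘ ι id = ι g`.
    rw [← Category.assoc, lanι_lanMap, Category.assoc, lanι_counitApp, Category.comp_id]
    exact (lanι_map _ _ _).trans (congrArg _ (Category.id_comp g))
  right_triangle_components S := Hom.app_injective fun X =>
    (lanι_counitApp S (𝟙 (J.obj X))).trans (S.map_id _)

end Extension

end RelativeMonad

theorem mainTheorem6 {𝕁 : Type u₁} [Category.{v₁} 𝕁] {C : Type u₂} [Category.{v₂} C]
    (J : 𝕁 ⥤ C) [WellBehaved J] :
    ∃ adj : RelativeMonad.extension J ⊣ RelativeMonad.restriction J,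
      (∀ (T : RelativeMonad J) (X : 𝕁),
        (adj.unit.app T).app X = (RelativeMonad.lanRho T.toFunctor).app X) ∧
      IsIso adj.unit := by
  have := WellBehaved.full (J := J)
  have := WellBehaved.faithful (J := J)
  refine ⟨RelativeMonad.extensionAdjunction J, fun _ _ => rfl, ?_⟩
  -- Invertibility is checked componentwise twice: over relative monads `T`, then over objects `X`.
  have (T : RelativeMonad J) : IsIso ((RelativeMonad.extensionAdjunction J).unit.app T) :=
    RelativeMonad.isIso_of_isIso_app _ fun X => RelativeMonad.isIso_lanRho_app T.toFunctor X
  exact NatIso.isIso_of_isIso_app _
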